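/- **Theorem 1.1.** For real $s\in(0,1)$ and $p>1$ with $sp=1$ and a measurable $u:\mathbb R\to\mathbb R$ put $$[u]:=\left(\int_{\mathbb R}\int_{\mathbb R}\frac{|u(x)-u(y)|^p}{|x-y|^2}\,dx\,dy\right)^{1/p},\qquad \|u\|_{W^{s,p}(\mathbb R)}:=\left(\|u\|_{L^p(\mathbb R)}^p+[u]^p\right)^{1/p},$$ and let $W^{s,p}(\mathbb R)=\{u\in L^p(\mathbb R):[u]<\infty\}$. For a nonempty bounded open interval $I\subset\mathbb R$ let $\tilde W^{s,p}_0(I)$ be the closure of $C_c^\infty(I)$ in $W^{s,p}(\mathbb R)$ with respect to $\|\cdot\|_{W^{s,p}(\mathbb R)}$, where functions in $C_c^\infty(I)$ are extended by zero, and for $\alpha\ge 0$ put $$S(\alpha,I):=\sup_{u\in\tilde W^{s,p}_0(I),\ [u]\le 1}\int_I e^{\alpha|u|^{1/(1-s)}}\,dx\in[0,\infty].$$ Let $s\in(0,1)$ and $p>1$ be such that $sp=1$. Then: 1. there exists $\alpha_*=\alpha_*(s)>0$, depending only on $s$, such that $S(\alpha,I)<\infty$ for every nonempty bounded open interval $I$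 and every $\alpha\in[0,\alpha_*)$; 2. with $$\gamma_s:=8\,\Gamma(p+1)\sum_{k=0}^\infty\frac1{(1+2k)^p},\qquad \alpha^*:=\gamma_s^{\frac{s}{1-s}},$$ one has $S(\alpha,I)=\infty$ for every nonempty bounded open interval $I$ and every $\alpha\in(\alpha^*,\infty)$. -/

import Mathlib

open MeasureTheory
open scoped ContDiff

noncomputable section

namespace FracMT

/-- The Gagliardo seminorm `[u]_{W^{s,p}(ℝ)}` of a real function on the line in the critical case
`s p = 1`, where the kernel `|x - y|^{-(1 + s p)}` is `|x - y|^{-2}`, as an extended non-negative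
real: `(∬ |u x - u y| ^ p / |x - y| ^ 2 dx dy) ^ (1 / p)`. -/
def gagliardo (p : ℝ) (u : ℝ → ℝ) : ENNReal :=
  (∫⁻ y : ℝ, ∫⁻ x : ℝ, ENNReal.ofReal (|u x - u y| ^ p / |x - y| ^ 2)) ^ (1 / p)

/-- The full norm `(‖u‖_{L^p(ℝ)} ^ p + [u] ^ p) ^ (1 / p)`. -/
def sobolevNorm (p : ℝ) (u : ℝ → ℝ) : ENNReal :=
  (eLpNorm u (ENNReal.ofReal p) volume ^ p + gagliardo p u ^ p) ^ (1 / p)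

/-- Membership in the Sobolev-Slobodeckij space `W^{s,p}(ℝ)`, `s p = 1`: `u ∈ L^p(ℝ)` with finite
Gagliardo seminorm. -/
def MemSobolev (p : ℝ) (u : ℝ → ℝ) : Prop :=
  MemLp u (ENNReal.ofReal p) volume ∧ gagliardo p u < ⊤

/-- `C^∞_0(I)`: smooth functions on the line with compact support contained in `I`. -/
def IsTest (I : Set ℝ) (φ : ℝ → ℝ) : Prop :=
  ContDiff ℝ ∞ φ ∧ HasCompactSupport φ ∧ tsupport φ ⊆ I

/-- Membership in `W̃^{s,p}_0(I)`, `s p = 1`: the closure of `C^∞_0(I)` in `W^{s,p}(ℝ)` with respect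
to the full norm. -/
def MemSobolevZero (p : ℝ) (I : Set ℝ) (u : ℝ → ℝ) : Prop :=
  MemSobolev p u ∧
    ∀ ε : ENNReal, 0 < ε → ∃ φ : ℝ → ℝ, IsTest I φ ∧ sobolevNorm p (fun x => u x - φ x) < ε

/-- `∫_I exp (α |u| ^ (1 / (1 - s))) dx`, as an extended non-negative real. -/
def expIntegral (s α : ℝ) (I : Set ℝ) (u : ℝ → ℝ) : ENNReal :=
  ∫⁻ x in I, ENNReal.ofReal (Real.exp (α * |u x| ^ (1 / (1 - s))))

/-- The supremum of `∫_I exp (α |u| ^ (1 / (1 - s))) dx` over all `u ∈ W̃^{s,p}_0(I)` with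
Gagliardo seminorm at most one. -/
def moserTrudingerSup (s p α : ℝ) (I : Set ℝ) : ENNReal :=
  ⨆ u ∈ {u : ℝ → ℝ | MemSobolevZero p I u ∧ gagliardo p u ≤ 1}, expIntegral s α I u

/-- `γ_s = 8 Γ(p + 1) ∑_{k ≥ 0} (1 + 2 k) ^ (-p)`, where `p = 1 / s`. The series converges since
`p > 1`. -/
def gammaConst (p : ℝ) : ℝ :=
  8 * Real.Gamma (p + 1) * ∑' k : ℕ, 1 / (1 + 2 * (k : ℝ)) ^ p

end FracMT

end

namespace FracMT

open Real Set Filter Topology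

/-! Divergence: for a function of `log |x|`, summing the kernel `|x - y|⁻² dx dy` over signs leaves
the convolution kernel `2 * logKernel h`, `h = log |x| - log |y|`. Its weighted moment of order `p`
is exactly `γ = gammaConst p`, so a smoothed Moser function falling with slope at most one over a
logarithmic length `L + 2` has energy at most `γ L + O(1)` (`energy_moser_le`). Normalised, it is at
least `L / (γ L + O(1)) ^ s` on an interval of length comparable to `exp (-L)`. The exponent there
grows like `α γ ^ (-s / (1 - s)) L`, which beats `L` exactly when `α` exceeds the threshold.

Finiteness: let `t k` be levels at which the distribution function of `|u|` falls to `|I| / 2 ^ k`.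
Interactions between `{|u| ≥ t (k + 1)}` and `{|u| ≤ t k}` cost at least half of `(t (k + 1) - t k)
^ p`, and these costs add up (`sum_level_gap_le_energy`). Hölder then gives `t n ^ (1 / (1 - s)) ≤ 2
^ (1 / (p - 1)) * n`, and the exponential integral is dominated by a geometric series. -/

/-! ### Integration in logarithmic coordinates. -/

theorem lintegral_eq_Ioi_add_Ioi_neg (g : ℝ → ENNReal) :
    ∫⁻ x, g x = (∫⁻ x in Ioi 0, g x) + ∫⁻ x in Ioi 0, g (-x) := by
  have h1 : ∫⁻ x in Ioi (0 : ℝ), g (-x) = ∫⁻ x in Iio (0 : ℝ), g x := by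
    have := (Measure.measurePreserving_neg (volume : Measure ℝ)).setLIntegral_comp_emb
      (MeasurableEquiv.neg ℝ).measurableEmbedding g (Ioi 0)
    simpa using this
  rw [h1, ← setLIntegral_congr (Iio_ae_eq_Iic (μ := volume) (a := (0 : ℝ))).symm, ← compl_Ioi,
    lintegral_add_compl _ measurableSet_Ioi]

theorem lintegral_comp_abs (g : ℝ → ENNReal) :
    ∫⁻ x, g |x| = 2 * ∫⁻ x in Ioi (0 : ℝ), g x := by
  rw [lintegral_eq_Ioi_add_Ioi_neg, two_mul]
  congr 1 <;> refine setLIntegral_congr_fun measurableSet_Ioi fun x hx => ?_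
  · simp [abs_of_pos (mem_Ioi.1 hx)]
  · simp [abs_of_pos (mem_Ioi.1 hx)]

theorem lintegral_eq_lintegral_exp {g : ℝ → ENNReal} (hg : Measurable g) :
    ∫⁻ x, g x = ∫⁻ t, ENNReal.ofReal (exp t) * (g (exp t) + g (-exp t)) := by
  have key : ∀ f : ℝ → ENNReal,
      ∫⁻ x in Ioi (0 : ℝ), f x = ∫⁻ t, ENNReal.ofReal (exp t) * f (exp t) := by
    intro f
    have := lintegral_image_eq_lintegral_abs_deriv_mul (s := univ) (f := exp) (f' := exp)
      MeasurableSet.univ (fun x _ => (hasDerivAt_exp x).hasDerivWithinAt) exp_injective.injOn f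
    simpa [range_exp] using this
  rw [lintegral_eq_Ioi_add_Ioi_neg, key, key fun x => g (-x), ← lintegral_add_left]
  · simp only [mul_add]
  · fun_prop

/-! ### The folded kernel and its moments. -/

/-- The kernel `|x - y|⁻² dx dy`, folded to the positive half-line and written in the variable
`h = log x - log y`. -/
noncomputable def logKernel (h : ℝ) : ℝ := exp h / (exp h - 1) ^ 2 + exp h / (exp h + 1) ^ 2

theorem logKernel_nonneg (h : ℝ) : 0 ≤ logKernel h := by
  unfold logKernel; positivity

theorem measurable_logKernel : Measurable logKernel := by
  unfold logKernel; fun_prop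

theorem logKernel_neg (h : ℝ) : logKernel (-h) = logKernel h := by
  unfold logKernel
  have e := exp_pos h
  rcases eq_or_ne (exp h) 1 with h1 | h1
  · simp [exp_neg, h1]
  · have : exp h - 1 ≠ 0 := sub_ne_zero.2 h1
    have : 1 - exp h ≠ 0 := sub_ne_zero.2 h1.symm
    rw [exp_neg]
    field_simp
    ring

theorem logKernel_abs (h : ℝ) : logKernel |h| = logKernel h := by
  rcases abs_choice h with h1 | h1 <;> rw [h1]
  exact logKernel_neg h

/-- With `q = exp (-h)` the kernel is `q / (1 - q) ^ 2 + q / (1 + q) ^ 2`. Even powers of `q` cancel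
and odd ones double, whence the odd integers in `gammaConst`. -/
theorem hasSum_logKernel {h : ℝ} (hh : 0 < h) :
    HasSum (fun k : ℕ => 2 * (1 + 2 * (k : ℝ)) * exp (-((1 + 2 * k) * h))) (logKernel h) := by
  set q := exp (-h) with hq
  have hq0 : 0 < q := exp_pos _
  have hq1 : q < 1 := by rw [hq, exp_lt_one_iff]; linarith
  have hq2 : q ^ 2 < 1 := by nlinarith
  have hn : ‖q ^ 2‖ < 1 := by rw [norm_of_nonneg (by positivity)]; exact hq2
  have h1 := (hasSum_coe_mul_geometric_of_norm_lt_one hn).mul_left (4 * q)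
  have h2 := (hasSum_geometric_of_norm_lt_one hn).mul_left (2 * q)
  have e1 : (fun k : ℕ => 2 * (1 + 2 * (k : ℝ)) * exp (-((1 + 2 * k) * h))) =
      fun k : ℕ => 4 * q * (k * (q ^ 2) ^ k) + 2 * q * (q ^ 2) ^ k := by
    funext k
    have : exp (-((1 + 2 * k) * h)) = q * (q ^ 2) ^ k := by
      rw [← pow_mul, ← pow_succ', hq, ← exp_nat_mul]
      congr 1; push_cast; ring
    rw [this]; ring
  have e2 : logKernel h = 4 * q * (q ^ 2 / (1 - q ^ 2) ^ 2) + 2 * q * (1 - q ^ 2)⁻¹ := by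
    have e : exp h = q⁻¹ := by rw [hq, exp_neg, inv_inv]
    have : 1 - q ≠ 0 := by linarith
    have h3 : 1 - q ^ 2 = (1 - q) * (1 + q) := by ring
    unfold logKernel
    rw [e, h3]
    field_simp
    ring
  rw [e1, e2]
  exact h1.add h2

theorem summable_one_div_odd_rpow {q : ℝ} (hq : 1 < q) :
    Summable fun k : ℕ => 1 / (1 + 2 * (k : ℝ)) ^ q := by
  have h1 : Summable fun k : ℕ => 1 / ((k + 1 : ℕ) : ℝ) ^ q :=
    (summable_nat_add_iff 1).2 (summable_one_div_nat_rpow.2 hq)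
  refine h1.of_nonneg_of_le (fun k => by positivity) fun k => ?_
  have : (0 : ℝ) ≤ k := k.cast_nonneg
  push_cast
  gcongr 1 / ?_ ^ q
  linarith

theorem gammaConst_pos {q : ℝ} (hq : 1 < q) : 0 < gammaConst q := by
  have h1 := (summable_one_div_odd_rpow hq).tsum_pos (fun k => by positivity) 0 (by simp)
  have h2 := Gamma_pos_of_pos (by linarith : 0 < q + 1)
  unfold gammaConst
  positivity

theorem lintegral_rpow_mul_exp_neg {q n : ℝ} (hq : 0 < q) (hn : 0 < n) :
    ∫⁻ h in Ioi (0 : ℝ), ENNReal.ofReal (h ^ q * exp (-(n * h))) =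
      ENNReal.ofReal ((1 / n) ^ (q + 1) * Gamma (q + 1)) := by
  have h1 := Real.integral_rpow_mul_exp_neg_mul_Ioi (a := q + 1) (by linarith) hn
  have h2 : IntegrableOn (fun x : ℝ => x ^ q * exp (-n * x ^ (1 : ℝ))) (Ioi 0) :=
    integrableOn_rpow_mul_exp_neg_mul_rpow (by linarith) one_pos hn
  simp only [add_sub_cancel_right] at h1
  rw [← h1, ofReal_integral_eq_lintegral_ofReal]
  · exact h2.congr_fun (fun x _ => by simp) measurableSet_Ioi
  · filter_upwards [ae_restrict_mem measurableSet_Ioi] with x hx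
    have : (0 : ℝ) < x := hx
    positivity

theorem lintegral_rpow_mul_logKernel {q : ℝ} (hq : 1 < q) :
    4 * ∫⁻ h in Ioi (0 : ℝ), ENNReal.ofReal (h ^ q * logKernel h) =
      ENNReal.ofReal (gammaConst q) := by
  have h1 : ∫⁻ h in Ioi (0 : ℝ), ENNReal.ofReal (h ^ q * logKernel h) =
      ∫⁻ h in Ioi (0 : ℝ), ∑' k : ℕ, ENNReal.ofReal (2 * (1 + 2 * (k : ℝ))) *
        ENNReal.ofReal (h ^ q * exp (-((1 + 2 * k) * h))) := by
    refine setLIntegral_congr_fun measurableSet_Ioi fun h hh => ?_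
    have hh : 0 < h := hh
    have hs := (hasSum_logKernel hh).mul_left (h ^ q)
    rw [← hs.tsum_eq, ENNReal.ofReal_tsum_of_nonneg (fun k => by positivity) hs.summable]
    refine tsum_congr fun k => ?_
    rw [← ENNReal.ofReal_mul (by positivity)]
    congr 1; ring
  rw [h1, lintegral_tsum (fun k => by fun_prop)]
  have h2 : ∀ k : ℕ, ∫⁻ h in Ioi (0 : ℝ), ENNReal.ofReal (2 * (1 + 2 * (k : ℝ))) *
        ENNReal.ofReal (h ^ q * exp (-((1 + 2 * k) * h))) =
      ENNReal.ofReal (2 * Gamma (q + 1) * (1 / (1 + 2 * (k : ℝ)) ^ q)) := by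
    intro k
    have hk : (0 : ℝ) < 1 + 2 * k := by positivity
    rw [lintegral_const_mul' _ _ ENNReal.ofReal_ne_top,
      lintegral_rpow_mul_exp_neg (by linarith) hk, ← ENNReal.ofReal_mul (by positivity)]
    congr 1
    rw [div_rpow zero_le_one hk.le, one_rpow, rpow_add_one hk.ne']
    field_simp
  have hG := Gamma_pos_of_pos (by linarith : 0 < q + 1)
  simp_rw [h2]
  rw [← ENNReal.ofReal_tsum_of_nonneg (fun k => by positivity)
    ((summable_one_div_odd_rpow hq).mul_left _), tsum_mul_left]
  rw [show (4 : ENNReal) = ENNReal.ofReal 4 by simp, ← ENNReal.ofReal_mul (by norm_num)]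
  unfold gammaConst
  congr 1; ring

/-! ### Energy of functions of `log |x|`. -/

/-- The double integral whose `p`-th root is the Gagliardo seminorm. -/
noncomputable def energy (p : ℝ) (u : ℝ → ℝ) : ENNReal :=
  ∫⁻ y : ℝ, ∫⁻ x : ℝ, ENNReal.ofReal (|u x - u y| ^ p / |x - y| ^ 2)

theorem gagliardo_eq (p : ℝ) (u : ℝ → ℝ) : gagliardo p u = energy p u ^ (1 / p) := rfl

theorem energy_congr_ae {p : ℝ} {u v : ℝ → ℝ} (h : u =ᵐ[volume] v) :
    energy p u = energy p v := by
  refine lintegral_congr_ae ?_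
  filter_upwards [h] with y hy
  refine lintegral_congr_ae ?_
  filter_upwards [h] with x hx
  rw [hx, hy]

theorem energy_comp_sub_right (p c : ℝ) (u : ℝ → ℝ) :
    energy p (fun x => u (x - c)) = energy p u := by
  unfold energy
  rw [← lintegral_sub_right_eq_self
    (fun y => ∫⁻ x, ENNReal.ofReal (|u x - u y| ^ p / |x - y| ^ 2)) c]
  refine lintegral_congr fun y => ?_
  rw [← lintegral_sub_right_eq_self
    (fun x => ENNReal.ofReal (|u x - u (y - c)| ^ p / |x - (y - c)| ^ 2)) c]
  simp only [sub_sub_sub_cancel_right]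

/-- The Jacobian `exp (t + r)` makes the kernel, summed over both signs of `x`, depend on `t - r`
alone. -/
theorem exp_mul_exp_mul_kernel {D t r : ℝ} (hD : t = r → D = 0) :
    exp r * (exp t * (D / |exp t - exp r| ^ 2 + D / |-exp t - exp r| ^ 2)) =
      D * logKernel (t - r) := by
  rcases eq_or_ne t r with h | h
  · simp [hD h]
  have ht := exp_pos t
  have hr := exp_pos r
  have h1 : exp t - exp r ≠ 0 := sub_ne_zero.2 fun e => h (exp_injective e)
  rw [sq_abs, sq_abs, logKernel, exp_sub,
    show (-exp t - exp r) ^ 2 = (exp t + exp r) ^ 2 by ring]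
  field_simp

theorem exp_mul_exp_mul_kernel_neg {D t r : ℝ} (hD : t = r → D = 0) :
    exp r * (exp t * (D / |exp t - -exp r| ^ 2 + D / |-exp t - -exp r| ^ 2)) =
      D * logKernel (t - r) := by
  rw [← exp_mul_exp_mul_kernel hD, abs_sub_comm (-exp t) (-exp r), add_comm (D / _),
    abs_sub_comm (exp t) (-exp r), sub_neg_eq_add, neg_add_eq_sub, ← abs_neg (-exp r - exp t),
    ← abs_neg (-exp t - exp r)]
  congr 5
  ring_nf

/-- Each sign of `y` contributes one `logKernel`, hence the factor two. -/
theorem energy_comp_log {p : ℝ} (hp : 0 < p) {F : ℝ → ℝ} (hF : Measurable F) :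
    energy p (fun x => F (log x)) =
      ∫⁻ h, ∫⁻ r, ENNReal.ofReal (2 * logKernel h) * ENNReal.ofReal (|F (h + r) - F r| ^ p) := by
  have hm : Measurable fun z : ℝ × ℝ => ENNReal.ofReal (|F (log z.1) - F (log z.2)| ^ p /
      |z.1 - z.2| ^ 2) := by fun_prop
  have hK := measurable_logKernel
  have h1 : energy p (fun x => F (log x)) =
      ∫⁻ r, ∫⁻ t, ENNReal.ofReal (2 * logKernel (t - r)) * ENNReal.ofReal (|F t - F r| ^ p) := by
    unfold energy
    rw [lintegral_eq_lintegral_exp hm.lintegral_prod_left']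
    refine lintegral_congr fun r => ?_
    have hD : ∀ t, t = r → |F t - F r| ^ p = 0 := fun t h => by simp [h, hp.ne']
    rw [lintegral_eq_lintegral_exp (g := fun x => ENNReal.ofReal (|F (log x) - F (log (exp r))| ^ p /
        |x - exp r| ^ 2)) (by fun_prop),
      lintegral_eq_lintegral_exp (g := fun x => ENNReal.ofReal (|F (log x) - F (log (-exp r))| ^ p /
        |x - -exp r| ^ 2)) (by fun_prop), mul_add, ← lintegral_const_mul' _ _ ENNReal.ofReal_ne_top,
      ← lintegral_const_mul' _ _ ENNReal.ofReal_ne_top, ← lintegral_add_left (by fun_prop)]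
    refine lintegral_congr fun t => ?_
    simp only [log_exp, log_neg_eq_log]
    rw [← ENNReal.ofReal_add (by positivity) (by positivity),
      ← ENNReal.ofReal_add (by positivity) (by positivity),
      ← ENNReal.ofReal_mul (exp_pos _).le, ← ENNReal.ofReal_mul (exp_pos _).le,
      ← ENNReal.ofReal_mul (exp_pos _).le, ← ENNReal.ofReal_mul (exp_pos _).le,
      exp_mul_exp_mul_kernel (hD t), exp_mul_exp_mul_kernel_neg (hD t),
      ← ENNReal.ofReal_add (mul_nonneg (by positivity) (logKernel_nonneg _))
        (mul_nonneg (by positivity) (logKernel_nonneg _)),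
      ← ENNReal.ofReal_mul (mul_nonneg zero_le_two (logKernel_nonneg _))]
    congr 1; ring
  rw [h1]
  have h2 : ∀ r, ∫⁻ t, ENNReal.ofReal (2 * logKernel (t - r)) * ENNReal.ofReal (|F t - F r| ^ p) =
      ∫⁻ h, ENNReal.ofReal (2 * logKernel h) * ENNReal.ofReal (|F (h + r) - F r| ^ p) := by
    intro r
    rw [← lintegral_add_right_eq_self _ r]
    simp only [add_sub_cancel_right]
  simp_rw [h2]
  exact lintegral_lintegral_swap (by fun_prop)

/-- The increment is at most `|h|`, and it vanishes off the window `[A, B]` widened by `|h|` on each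
side. -/
theorem lintegral_abs_sub_rpow_le {p : ℝ} (hp : 0 < p) {F : ℝ → ℝ} {A B : ℝ}
    (hF : ∀ t r, |F t - F r| ≤ |t - r|) (hA : ∀ t ≤ A, F t = F A) (hB : ∀ t, B ≤ t → F t = F B)
    (h : ℝ) : ∫⁻ r, ENNReal.ofReal (|F (h + r) - F r| ^ p) ≤
      ENNReal.ofReal (|h| ^ p * (B - A + 2 * |h|)) := by
  have h1 : ∀ r, ENNReal.ofReal (|F (h + r) - F r| ^ p) ≤
      (Icc (A - |h|) (B + |h|)).indicator (fun _ => ENNReal.ofReal (|h| ^ p)) r := by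
    intro r
    by_cases hr : r ∈ Icc (A - |h|) (B + |h|)
    · rw [indicator_of_mem hr]
      have := hF (h + r) r
      rw [add_sub_cancel_right] at this
      gcongr
    · rw [indicator_of_notMem hr]
      have h2 := le_abs_self h
      have h3 := neg_abs_le h
      have : F (h + r) = F r := by
        rw [mem_Icc, not_and_or, not_le, not_le] at hr
        rcases hr with hr | hr
        · rw [hA r (by linarith [abs_nonneg h]), hA (h + r) (by linarith)]
        · rw [hB r (by linarith [abs_nonneg h]), hB (h + r) (by linarith)]
      simp [this, hp.ne']
  refine (lintegral_mono h1).trans ?_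
  rw [lintegral_indicator_const measurableSet_Icc, Real.volume_Icc,
    ← ENNReal.ofReal_mul (by positivity)]
  apply le_of_eq; congr 2; ring

/-- A function of `log |x|` with slope at most one that is constant off a window of length `ℓ` has
energy at most `γ ℓ + O(1)`. -/
theorem energy_le_of_eq_comp_log {p : ℝ} (hp : 1 < p) {F : ℝ → ℝ} {A B : ℝ} (hAB : A ≤ B)
    (hF : ∀ t r, |F t - F r| ≤ |t - r|) (hA : ∀ t ≤ A, F t = F A) (hB : ∀ t, B ≤ t → F t = F B)
    {w : ℝ → ℝ} (hw : ∀ x, x ≠ 0 → w x = F (log x)) :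
    energy p w ≤ ENNReal.ofReal (gammaConst p * (B - A) + 2 * gammaConst (p + 1)) := by
  have hFm : Measurable F :=
    (LipschitzWith.of_dist_le_mul (K := 1) fun t r => by simpa [Real.dist_eq] using hF t r)
      |>.continuous.measurable
  have hp0 : 0 < p := by linarith
  have hae : w =ᵐ[volume] fun x => F (log x) := by
    filter_upwards [Measure.ae_ne volume 0] with x hx using hw x hx
  rw [energy_congr_ae hae, energy_comp_log hp0 hFm]
  have hK := measurable_logKernel
  calc _ ≤ ∫⁻ h, (fun h => ENNReal.ofReal (2 * logKernel h) *
        ENNReal.ofReal (h ^ p * (B - A + 2 * h))) |h| := by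
        refine lintegral_mono fun h => ?_
        beta_reduce
        rw [lintegral_const_mul' _ _ ENNReal.ofReal_ne_top, logKernel_abs]
        gcongr
        exact lintegral_abs_sub_rpow_le hp0 hF hA hB h
    _ = 2 * ∫⁻ h in Ioi (0 : ℝ), (ENNReal.ofReal (2 * (B - A)) *
          ENNReal.ofReal (h ^ p * logKernel h) +
        ENNReal.ofReal 4 * ENNReal.ofReal (h ^ (p + 1) * logKernel h)) := by
        rw [lintegral_comp_abs fun h => ENNReal.ofReal (2 * logKernel h) *
          ENNReal.ofReal (h ^ p * (B - A + 2 * h))]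
        congr 1
        refine setLIntegral_congr_fun measurableSet_Ioi fun h hh => ?_
        have hh : 0 < h := hh
        have h3 := logKernel_nonneg h
        have h4 : 0 ≤ B - A := by linarith
        rw [← ENNReal.ofReal_mul (by positivity), ← ENNReal.ofReal_mul (by positivity),
          ← ENNReal.ofReal_mul (by positivity), ← ENNReal.ofReal_add (by positivity)
            (by positivity), rpow_add_one hh.ne']
        congr 1; ring
    _ = ENNReal.ofReal (B - A) * (4 * ∫⁻ h in Ioi (0 : ℝ), ENNReal.ofReal (h ^ p * logKernel h)) +
        2 * (4 * ∫⁻ h in Ioi (0 : ℝ), ENNReal.ofReal (h ^ (p + 1) * logKernel h)) := by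
        rw [lintegral_add_left (by fun_prop), lintegral_const_mul' _ _ ENNReal.ofReal_ne_top,
          lintegral_const_mul' _ _ ENNReal.ofReal_ne_top, ENNReal.ofReal_mul zero_le_two]
        simp only [ENNReal.ofReal_ofNat]
        ring
    _ = _ := by
        have h1 := gammaConst_pos hp
        have h2 := gammaConst_pos (by linarith : 1 < p + 1)
        rw [lintegral_rpow_mul_logKernel hp, lintegral_rpow_mul_logKernel (by linarith),
          ENNReal.ofReal_add (by nlinarith) (by positivity), ENNReal.ofReal_mul h1.le,
          ENNReal.ofReal_mul zero_le_two, ENNReal.ofReal_ofNat, mul_comm (ENNReal.ofReal (B - A))]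

theorem energy_const_mul {p : ℝ} (κ : ℝ) (u : ℝ → ℝ) :
    energy p (fun x => κ * u x) = ENNReal.ofReal (|κ| ^ p) * energy p u := by
  unfold energy
  simp_rw [← mul_sub, abs_mul, mul_rpow (abs_nonneg _) (abs_nonneg _), mul_div_assoc,
    ENNReal.ofReal_mul (rpow_nonneg (abs_nonneg κ) p),
    lintegral_const_mul' _ _ ENNReal.ofReal_ne_top]

theorem IsTest.const_mul {I : Set ℝ} {φ : ℝ → ℝ} (hφ : IsTest I φ) (κ : ℝ) :
    IsTest I fun x => κ * φ x :=
  ⟨contDiff_const.mul hφ.1, hφ.2.1.mul_left, (tsupport_mul_subset_right).trans hφ.2.2⟩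

theorem IsTest.memSobolevZero {p : ℝ} (hp : 0 < p) {I : Set ℝ} {φ : ℝ → ℝ} (hφ : IsTest I φ)
    (hE : gagliardo p φ < ⊤) : MemSobolevZero p I φ := by
  refine ⟨⟨hφ.1.continuous.memLp_of_hasCompactSupport hφ.2.1, hE⟩, fun ε hε => ⟨φ, hφ, ?_⟩⟩
  simpa [sobolevNorm, gagliardo, hp, hp.ne'] using hε

/-! ### Smoothed Moser functions. -/

/-- A smooth bump that is one on `[1, L + 1]` and vanishes outside `[0, L + 2]`. -/
noncomputable def slope (L t : ℝ) : ℝ := smoothTransition t * smoothTransition (L + 2 - t)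

/-- A smooth function falling from a plateau of height at least `L` on `(-∞, 0]` to zero on
`[L + 2, ∞)`, with slope at most one. -/
noncomputable def ramp (L t : ℝ) : ℝ := ∫ τ in t..(L + 2), slope L τ

theorem contDiff_slope (L : ℝ) : ContDiff ℝ ∞ (slope L) :=
  smoothTransition.contDiff.mul (smoothTransition.contDiff.comp (contDiff_const.sub contDiff_id))

theorem slope_nonneg (L t : ℝ) : 0 ≤ slope L t :=
  mul_nonneg (smoothTransition.nonneg _) (smoothTransition.nonneg _)

theorem slope_le_one (L t : ℝ) : slope L t ≤ 1 :=
  mul_le_one₀ (smoothTransition.le_one _) (smoothTransition.nonneg _) (smoothTransition.le_one _)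

theorem intervalIntegrable_slope (L a b : ℝ) : IntervalIntegrable (slope L) volume a b :=
  (contDiff_slope L).continuous.intervalIntegrable _ _

theorem ramp_sub (L t r : ℝ) : ramp L t - ramp L r = ∫ τ in t..r, slope L τ := by
  exact sub_eq_of_eq_add (intervalIntegral.integral_add_adjacent_intervals
    (intervalIntegrable_slope _ _ _) (intervalIntegrable_slope _ _ _)).symm

theorem abs_ramp_sub_le (L t r : ℝ) : |ramp L t - ramp L r| ≤ |t - r| := by
  rw [ramp_sub, abs_sub_comm t r]
  simpa using intervalIntegral.norm_integral_le_of_norm_le_const (a := t) (b := r) (C := 1)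
    (f := slope L) fun x _ => by
      rw [norm_of_nonneg (slope_nonneg L x)]; exact slope_le_one L x

theorem ramp_eq_ramp_zero {L t : ℝ} (ht : t ≤ 0) : ramp L t = ramp L 0 := by
  rw [← sub_eq_zero, ramp_sub]
  refine intervalIntegral.integral_zero_ae (ae_of_all _ fun x hx => ?_)
  rw [uIoc_of_le ht] at hx
  simp [slope, smoothTransition.zero_of_nonpos hx.2]

theorem ramp_eq_zero {L t : ℝ} (ht : L + 2 ≤ t) : ramp L t = 0 := by
  unfold ramp
  refine intervalIntegral.integral_zero_ae (ae_of_all _ fun x hx => ?_)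
  rw [uIoc_of_ge ht] at hx
  simp [slope, smoothTransition.zero_of_nonpos (by linarith [hx.1] : L + 2 - x ≤ 0)]

theorem le_ramp_zero {L : ℝ} (hL : 0 ≤ L) : L ≤ ramp L 0 := by
  have h1 : ∫ τ in (1 : ℝ)..(L + 1), slope L τ = ∫ τ in (1 : ℝ)..(L + 1), (1 : ℝ) := by
    refine intervalIntegral.integral_congr fun x hx => ?_
    rw [uIcc_of_le (by linarith)] at hx
    simp [slope, smoothTransition.one_of_one_le hx.1,
      smoothTransition.one_of_one_le (by linarith [hx.2] : 1 ≤ L + 2 - x)]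
  have h2 := intervalIntegral.integral_mono_interval (c := 0) (d := L + 2) (a := 1) (b := L + 1)
    zero_le_one (by linarith) (by linarith)
    (ae_of_all (volume.restrict (Ioc 0 (L + 2))) fun x => slope_nonneg L x)
    (intervalIntegrable_slope _ _ _)
  rw [h1] at h2
  simpa [ramp] using h2

theorem contDiff_ramp (L : ℝ) : ContDiff ℝ ∞ (ramp L) := by
  have h : ∀ t, HasDerivAt (ramp L) (-slope L t) t := fun t =>
    intervalIntegral.integral_hasDerivAt_left (intervalIntegrable_slope _ _ _)
      ((contDiff_slope L).continuous.stronglyMeasurableAtFilter _ _)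
      (contDiff_slope L).continuous.continuousAt
  refine contDiff_infty_iff_deriv.2 ⟨fun t => (h t).differentiableAt, ?_⟩
  rw [show deriv (ramp L) = fun t => -slope L t from funext fun t => (h t).deriv]
  exact (contDiff_slope L).neg

/-- The smoothed Moser function `x ↦ ramp L (log (lam |x|))`. -/
noncomputable def moser (L lam x : ℝ) : ℝ := ramp L (log (lam * x))

theorem moser_of_le_one {L lam x : ℝ} (h : |lam * x| ≤ 1) : moser L lam x = ramp L 0 := by
  refine ramp_eq_ramp_zero ?_
  rw [← log_abs]
  exact log_nonpos (abs_nonneg _) h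

/-- The plateau of `ramp` hides the singularity of the logarithm: the function is constant near the
origin, also at it, since `log 0 = 0` lies on the plateau. -/
theorem contDiff_moser (L lam : ℝ) : ContDiff ℝ ∞ (moser L lam) := by
  refine contDiff_iff_contDiffAt.2 fun x => ?_
  have hlin : ContDiff ℝ ∞ fun x : ℝ => lam * x := contDiff_const.mul contDiff_id
  rcases eq_or_ne (lam * x) 0 with h | h
  · have hev : moser L lam =ᶠ[𝓝 x] fun _ => ramp L 0 := by
      have : Tendsto (fun x : ℝ => |lam * x|) (𝓝 x) (𝓝 |lam * x|) :=
        (hlin.continuous.abs).continuousAt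
      rw [h, abs_zero] at this
      filter_upwards [this.eventually_le_const one_pos] with y hy using moser_of_le_one hy
    exact contDiffAt_const.congr_of_eventuallyEq hev
  · exact (contDiff_ramp L).contDiffAt.comp x ((contDiffAt_log.2 h).comp x hlin.contDiffAt)

theorem support_moser_subset {L lam : ℝ} (hlam : 0 < lam) :
    Function.support (moser L lam) ⊆ Icc (-(exp (L + 2) / lam)) (exp (L + 2) / lam) := by
  intro x hx
  rw [mem_Icc, ← abs_le]
  by_contra! hcon
  refine hx (ramp_eq_zero ?_)
  rw [div_lt_iff₀ hlam] at hcon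
  rw [← log_abs, abs_mul, abs_of_pos hlam, mul_comm, le_log_iff_exp_le ((exp_pos _).trans hcon)]
  exact hcon.le

theorem energy_moser_le {p L lam : ℝ} (hp : 1 < p) (hL : 0 ≤ L) (hlam : 0 < lam) :
    energy p (moser L lam) ≤
      ENNReal.ofReal (gammaConst p * L + 2 * (gammaConst p + gammaConst (p + 1))) := by
  refine (energy_le_of_eq_comp_log hp (F := fun t => ramp L (log lam + t)) (A := -log lam)
    (B := L + 2 - log lam) (by linarith) (fun t r => ?_) (fun t ht => ?_) (fun t ht => ?_)
    fun x hx => ?_).trans_eq ?_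
  · simpa using abs_ramp_sub_le L (log lam + t) (log lam + r)
  · rw [ramp_eq_ramp_zero (by linarith), add_neg_cancel]
  · rw [ramp_eq_zero (by linarith), ramp_eq_zero (by linarith)]
  · rw [moser, log_mul hlam.ne' hx]
  · congr 1; ring

theorem isTest_moser {L a b : ℝ} (hab : a < b) :
    IsTest (Ioo a b) fun x => moser L (exp (L + 2) / ((b - a) / 4)) (x - (a + b) / 2) := by
  have hr : 0 < (b - a) / 4 := by linarith
  have hlam : 0 < exp (L + 2) / ((b - a) / 4) := by positivity
  -- This dilation makes the support radius `exp (L + 2) / lam` a quarter of the length of the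
  -- interval.
  set lam := exp (L + 2) / ((b - a) / 4) with hl
  have hq : exp (L + 2) / lam = (b - a) / 4 := by
    rw [hl]; field_simp
  have hsub : Function.support (fun x => moser L lam (x - (a + b) / 2)) ⊆
      Icc ((a + b) / 2 - (b - a) / 4) ((a + b) / 2 + (b - a) / 4) := by
    intro x hx
    have := support_moser_subset (L := L) hlam hx
    rw [hq] at this
    exact ⟨by linarith [this.1], by linarith [this.2]⟩
  refine ⟨(contDiff_moser L lam).comp (contDiff_id.sub contDiff_const),
    .of_support_subset_isCompact isCompact_Icc hsub,
    (closure_minimal hsub isClosed_Icc).trans fun x hx => ?_⟩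
  exact ⟨by linarith [hx.1], by linarith [hx.2]⟩

/-! ### Divergence above the threshold. -/

theorem ofReal_le_moserTrudingerSup {s p a b α L : ℝ} (hs1 : s < 1) (hp : 1 < p)
    (hab : a < b) (hα : 0 ≤ α) (hL : 0 ≤ L) :
    ENNReal.ofReal ((b - a) / 2 * exp (-(L + 2)) * exp (α * (L / (gammaConst p * L +
      2 * (gammaConst p + gammaConst (p + 1))) ^ (1 / p)) ^ (1 / (1 - s)))) ≤
      moserTrudingerSup s p α (Ioo a b) := by
  have hp0 : 0 < p := by linarith
  have hg1 := gammaConst_pos hp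
  have hg2 := gammaConst_pos (by linarith : 1 < p + 1)
  set Q := gammaConst p * L + 2 * (gammaConst p + gammaConst (p + 1)) with hQ
  have hQ0 : 0 < Q := by positivity
  set c := (a + b) / 2 with hc
  set ρ := (b - a) / 4 with hρ
  have hρ0 : 0 < ρ := by linarith
  set lam := exp (L + 2) / ρ with hlam
  have hlam0 : 0 < lam := by positivity
  -- `Q` bounds the energy of the Moser function, so this factor brings the energy below one.
  set κ := (Q ^ (1 / p))⁻¹ with hκ
  have hκ0 : 0 < κ := by positivity
  set v : ℝ → ℝ := fun x => κ * moser L lam (x - c) with hv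
  have hE : energy p v ≤ 1 := by
    rw [hv, energy_const_mul, energy_comp_sub_right p c (moser L lam)]
    calc _ ≤ ENNReal.ofReal (|κ| ^ p) * ENNReal.ofReal Q := by
          gcongr; exact energy_moser_le hp hL hlam0
      _ = 1 := by
          rw [← ENNReal.ofReal_mul (by positivity), abs_of_pos hκ0, hκ, inv_rpow (by positivity),
            ← rpow_mul hQ0.le, one_div_mul_cancel hp0.ne', rpow_one, inv_mul_cancel₀ hQ0.ne',
            ENNReal.ofReal_one]
  have hG : gagliardo p v ≤ 1 := by
    rw [gagliardo_eq]
    exact ENNReal.rpow_le_one hE (by positivity)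
  have hmem : MemSobolevZero p (Ioo a b) v :=
    ((isTest_moser hab).const_mul κ).memSobolevZero hp0 (hG.trans_lt ENNReal.one_lt_top)
  refine le_trans ?_ (le_iSup₂ (f := fun u (_ : u ∈ {u : ℝ → ℝ | MemSobolevZero p (Ioo a b) u ∧
    gagliardo p u ≤ 1}) => expIntegral s α (Ioo a b) u) v ⟨hmem, hG⟩)
  have hsub : Ioo (c - lam⁻¹) (c + lam⁻¹) ⊆ Ioo a b := by
    have : lam⁻¹ ≤ ρ := by
      rw [hlam, inv_div]
      exact div_le_self hρ0.le (one_le_exp (by linarith))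
    exact Ioo_subset_Ioo (by linarith) (by linarith)
  unfold expIntegral
  calc _ = ENNReal.ofReal (exp (α * (L / Q ^ (1 / p)) ^ (1 / (1 - s)))) *
          volume (Ioo (c - lam⁻¹) (c + lam⁻¹)) := by
        rw [Real.volume_Ioo, ← ENNReal.ofReal_mul (exp_pos _).le]
        congr 1
        rw [hlam, inv_div, exp_neg, hρ]
        ring
    _ = ∫⁻ x in Ioo (c - lam⁻¹) (c + lam⁻¹),
          ENNReal.ofReal (exp (α * (L / Q ^ (1 / p)) ^ (1 / (1 - s)))) := by
        rw [setLIntegral_const]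
    _ ≤ ∫⁻ x in Ioo (c - lam⁻¹) (c + lam⁻¹),
          ENNReal.ofReal (exp (α * |v x| ^ (1 / (1 - s)))) := by
        refine setLIntegral_mono' measurableSet_Ioo fun x hx => ?_
        have hx1 : |lam * (x - c)| ≤ 1 := by
          rw [abs_mul, abs_of_pos hlam0, ← le_div_iff₀' hlam0, one_div, abs_le]
          exact ⟨by linarith [hx.1], by linarith [hx.2]⟩
        have h1 : L / Q ^ (1 / p) ≤ |v x| := by
          rw [hv]
          beta_reduce
          rw [moser_of_le_one hx1, abs_mul, abs_of_pos hκ0, hκ, div_eq_inv_mul]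
          gcongr
          exact (le_ramp_zero hL).trans (le_abs_self _)
        have : 0 ≤ 1 / (1 - s) := by
          have : 0 < 1 - s := by linarith
          positivity
        gcongr
    _ ≤ _ := lintegral_mono_set hsub

theorem moserTrudingerSup_eq_top {s p a b α : ℝ} (hs0 : 0 < s) (hs1 : s < 1) (hp : 1 < p)
    (hsp : s * p = 1) (hab : a < b) (hα : gammaConst p ^ (s / (1 - s)) < α) :
    moserTrudingerSup s p α (Ioo a b) = ⊤ := by
  have hg1 := gammaConst_pos hp
  have hg2 := gammaConst_pos (by linarith : 1 < p + 1)
  set γ := gammaConst p with hγ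
  set C := 2 * (γ + gammaConst (p + 1)) with hC
  have hC0 : 0 < C := by positivity
  set σ := s / (1 - s) with hσ
  have h1s : 0 < 1 - s := by linarith
  have hσ0 : 0 < σ := by positivity
  have hγσ : 0 < γ ^ σ := by positivity
  have hα0 : 0 < α := hγσ.trans hα
  have hps : 1 / p = s := by field_simp; linarith
  have hlim1 : Tendsto (fun L : ℝ => L / (γ * L + C)) atTop (𝓝 (1 / γ)) := by
    have h : Tendsto (fun L : ℝ => 1 / (γ + C / L)) atTop (𝓝 (1 / (γ + 0))) :=
      tendsto_const_nhds.div (tendsto_const_nhds.add (tendsto_const_nhds.div_atTop tendsto_id))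
        (by simpa using hg1.ne')
    rw [add_zero] at h
    refine h.congr' ?_
    filter_upwards [eventually_gt_atTop 0] with L hL
    field_simp
  have hlim2 : Tendsto (fun L : ℝ => α * (L / (γ * L + C)) ^ σ - 1) atTop
      (𝓝 (α * (1 / γ) ^ σ - 1)) :=
    ((hlim1.rpow_const (Or.inr hσ0.le)).const_mul α).sub_const 1
  have hpos : 0 < α * (1 / γ) ^ σ - 1 := by
    rw [div_rpow zero_le_one hg1.le, one_rpow, mul_one_div, sub_pos, one_lt_div hγσ]
    exact hα
  have hlim3 : Tendsto (fun L : ℝ => (b - a) / 2 * exp (-2) *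
      exp (L * (α * (L / (γ * L + C)) ^ σ - 1))) atTop atTop :=
    (tendsto_exp_atTop.comp (tendsto_id.atTop_mul_pos hpos hlim2)).const_mul_atTop
      (mul_pos (by linarith) (exp_pos _))
  refine top_unique (le_of_tendsto (ENNReal.tendsto_ofReal_atTop.comp hlim3) ?_)
  filter_upwards [eventually_gt_atTop 0] with L hL
  refine le_trans (le_of_eq ?_) (ofReal_le_moserTrudingerSup hs1 hp hab hα0.le hL.le)
  have hQ0 : 0 < γ * L + C := by positivity
  rw [Function.comp_apply]
  congr 1
  -- Because `1 / p = s` and `1 / (1 - s) = 1 + σ`, one factor `L` splits off, to be compared with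
  -- the `exp (-L)` of the plateau length.
  have : (L / (γ * L + C) ^ (1 / p)) ^ (1 / (1 - s)) = L * (L / (γ * L + C)) ^ σ := by
    rw [div_rpow hL.le (by positivity), div_rpow hL.le hQ0.le, ← rpow_mul hQ0.le, hps,
      show s * (1 / (1 - s)) = σ by rw [hσ]; ring,
      show 1 / (1 - s) = 1 + σ by rw [hσ]; field_simp; ring, rpow_add hL, rpow_one]
    ring
  rw [this, mul_assoc, mul_assoc, ← exp_add, ← exp_add]
  congr 2
  ring

/-! ### Vanishing outside the interval, and dyadic levels. -/

/-- Off `I` the approximant `φ` vanishes, so the `L^p` norm of `u` there is that of `u - φ`, which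
is arbitrarily small. -/
theorem MemSobolevZero.ae_eq_zero {p : ℝ} (hp : 1 < p) {I : Set ℝ} (hI : MeasurableSet I)
    {u : ℝ → ℝ} (hu : MemSobolevZero p I u) : ∀ᵐ x, x ∉ I → u x = 0 := by
  have hp0 : 0 < p := by linarith
  have h0 : eLpNorm u (ENNReal.ofReal p) (volume.restrict Iᶜ) = 0 := by
    refine le_antisymm (ENNReal.le_of_forall_pos_le_add fun ε hε _ => ?_) zero_le
    obtain ⟨φ, hφ, hlt⟩ := hu.2 ε (by exact_mod_cast hε)
    have h1 : eLpNorm u (ENNReal.ofReal p) (volume.restrict Iᶜ) =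
        eLpNorm (fun x => u x - φ x) (ENNReal.ofReal p) (volume.restrict Iᶜ) := by
      refine eLpNorm_congr_ae ?_
      filter_upwards [ae_restrict_mem hI.compl] with x hx
      rw [image_eq_zero_of_notMem_tsupport fun h => hx (hφ.2.2 h), sub_zero]
    rw [h1, zero_add]
    refine (eLpNorm_mono_measure _ Measure.restrict_le_self).trans (le_trans ?_ hlt.le)
    unfold sobolevNorm
    calc _ = (eLpNorm (fun x => u x - φ x) (ENNReal.ofReal p) volume ^ p) ^ (1 / p) := by
          rw [← ENNReal.rpow_mul, mul_one_div_cancel hp0.ne', ENNReal.rpow_one]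
      _ ≤ _ := by gcongr; exact le_self_add
  rw [eLpNorm_eq_zero_iff hu.1.1.1.restrict (by simpa using hp0)] at h0
  exact (ae_restrict_iff' hI.compl).1 h0

section Level

variable {X : Type*} [MeasurableSpace X] {μ : Measure X} {f : X → ℝ}

/-- A level at which the distribution function of `f` crosses the value `m`. -/
theorem exists_level (hf : Measurable f) (hfin : μ {x | 0 < f x} ≠ ⊤) {m : ENNReal} (hm : 0 < m) :
    ∃ t : ℝ, 0 ≤ t ∧ μ {x | t < f x} ≤ m ∧ (∀ r, 0 ≤ r → r < t → m < μ {x | r < f x}) ∧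
      (0 < t → m ≤ μ {x | t ≤ f x}) := by
  have hmeas : ∀ r, MeasurableSet {x | r < f x} := fun r => measurableSet_lt measurable_const hf
  -- The level is `sInf S`: continuity from below of the measure gives the upper bound on `{t < f}`,
  -- continuity from above the lower bound on `{t ≤ f}`.
  set S := {t : ℝ | 0 ≤ t ∧ μ {x | t < f x} ≤ m} with hS
  have hbdd : BddBelow S := ⟨0, fun t ht => ht.1⟩
  have hne : S.Nonempty := by
    have h1 := tendsto_measure_iInter_atTop (μ := μ) (s := fun n : ℕ => {x | (n : ℝ) < f x})
      (fun n => (hmeas n).nullMeasurableSet)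
      (fun i j hij x (hx : (j : ℝ) < f x) => lt_of_le_of_lt (Nat.cast_le.2 hij) hx)
      ⟨0, by simpa using hfin⟩
    have h2 : ⋂ n : ℕ, {x | (n : ℝ) < f x} = ∅ := by
      ext x
      obtain ⟨n, hn⟩ := exists_nat_ge (f x)
      simpa using ⟨n, hn⟩
    rw [h2, measure_empty] at h1
    obtain ⟨n, hn⟩ := (h1.eventually_le_const hm).exists
    exact ⟨n, n.cast_nonneg, hn⟩
  have hlow : ∀ r, 0 ≤ r → r < sInf S → m < μ {x | r < f x} := by
    intro r hr hrt
    by_contra! hcon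
    exact absurd (csInf_le hbdd ⟨hr, hcon⟩) (not_le.2 hrt)
  refine ⟨sInf S, le_csInf hne fun t ht => ht.1, ?_, hlow, fun hpos => ?_⟩
  · have h1 : {x | sInf S < f x} = ⋃ n : ℕ, {x | sInf S + 1 / ((n : ℝ) + 1) < f x} := by
      ext x
      simp only [mem_ofPred_eq, mem_iUnion]
      constructor
      · intro h
        obtain ⟨n, hn⟩ := exists_nat_one_div_lt (sub_pos.2 h)
        exact ⟨n, by linarith⟩
      · rintro ⟨n, hn⟩
        have : (0 : ℝ) < 1 / ((n : ℝ) + 1) := by positivity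
        linarith
    have h2 : Monotone fun n : ℕ => {x | sInf S + 1 / ((n : ℝ) + 1) < f x} := by
      intro i j hij x hx
      have := one_div_le_one_div_of_le (by positivity : (0 : ℝ) < (i : ℝ) + 1)
        (by simpa using hij : (i : ℝ) + 1 ≤ (j : ℝ) + 1)
      simp only [mem_ofPred_eq] at hx ⊢
      linarith
    rw [h1, h2.measure_iUnion]
    refine iSup_le fun n => ?_
    obtain ⟨t, ht, hlt⟩ := exists_lt_of_csInf_lt hne
      (lt_add_of_pos_right (sInf S) (by positivity : (0 : ℝ) < 1 / ((n : ℝ) + 1)))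
    exact (measure_mono fun x (hx : _ < f x) => hlt.trans hx).trans ht.2
  · set t := sInf S
    have h1 : {x | t ≤ f x} = ⋂ n : ℕ, {x | t - t / ((n : ℝ) + 1) < f x} := by
      ext x
      simp only [mem_ofPred_eq, mem_iInter]
      constructor
      · intro h n
        have : (0 : ℝ) < t / ((n : ℝ) + 1) := by positivity
        linarith
      · intro h
        by_contra! hcon
        obtain ⟨n, hn⟩ := exists_nat_one_div_lt (div_pos (sub_pos.2 hcon) hpos)
        have h3 := h n
        rw [lt_div_iff₀ hpos, one_div_mul_eq_div] at hn
        linarith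
    have h2 : Antitone fun n : ℕ => {x | t - t / ((n : ℝ) + 1) < f x} := by
      intro i j hij x hx
      have : t / ((j : ℝ) + 1) ≤ t / ((i : ℝ) + 1) := by gcongr
      simp only [mem_ofPred_eq] at hx ⊢
      linarith
    rw [h1, h2.measure_iInter (fun n => (hmeas _).nullMeasurableSet) ⟨0, by simpa using hfin⟩]
    refine le_iInf fun n => (hlow _ ?_ ?_).le
    · exact sub_nonneg.2 (div_le_self hpos.le (by simp))
    · have : (0 : ℝ) < t / ((n : ℝ) + 1) := by positivity
      linarith

/-- Levels at which the distribution function halves. -/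
theorem exists_dyadic_levels (hf : Measurable f) {l : ℝ} (hl : 0 < l)
    (hfin : μ {x | 0 < f x} ≤ ENNReal.ofReal l) :
    ∃ t : ℕ → ℝ, t 0 = 0 ∧ Monotone t ∧ (∀ k, μ {x | t k < f x} ≤ ENNReal.ofReal (l / 2 ^ k)) ∧
      ∀ k, t k < t (k + 1) → ENNReal.ofReal (l / 2 ^ (k + 1)) ≤ μ {x | t (k + 1) ≤ f x} := by
  choose t ht0 ht1 ht2 ht3 using fun k : ℕ =>
    exists_level hf (ne_top_of_le_ne_top ENNReal.ofReal_ne_top hfin)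
      (ENNReal.ofReal_pos.2 (by positivity : 0 < l / 2 ^ k))
  refine ⟨t, ?_, monotone_nat_of_le_succ fun k => ?_, ht1, fun k hk =>
    ht3 (k + 1) ((ht0 k).trans_lt hk)⟩
  · by_contra hne
    have := ht2 0 0 le_rfl (lt_of_le_of_ne (ht0 0) (Ne.symm hne))
    simp only [pow_zero, div_one] at this
    exact absurd hfin (not_le.2 this)
  · by_contra! hlt
    refine absurd (ht2 k _ (ht0 _) hlt) (not_lt.2 ((ht1 (k + 1)).trans ?_))
    gcongr
    · norm_num
    · simp

/-- This direction holds for arbitrary integrands, which spares any measurability check on inner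
integrals. -/
theorem sum_lintegral_le {ι : Type*} (s : Finset ι) (g : ι → X → ENNReal) :
    ∑ i ∈ s, ∫⁻ x, g i x ∂μ ≤ ∫⁻ x, ∑ i ∈ s, g i x ∂μ := by
  classical
  induction s using Finset.induction_on with
  | empty => simp
  | insert i s hi ih =>
    simp only [Finset.sum_insert hi]
    exact (add_le_add_right ih _).trans (le_lintegral_add _ _)

end Level

/-! ### Energy bounded below by level gaps. -/

/-- The interval of radius `m` about `y` has length `2 m`, so it meets `S` in measure at least `m`,
and there the kernel is at least `m⁻²` almost everywhere. -/
theorem ofReal_inv_le_lintegral_kernel {S : Set ℝ} (hS : MeasurableSet S) {m : ℝ} (hm : 0 < m)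
    (hvol : volume Sᶜ ≤ ENNReal.ofReal m) (y : ℝ) :
    ENNReal.ofReal m⁻¹ ≤ ∫⁻ x in S, ENNReal.ofReal (1 / |x - y| ^ 2) := by
  have hT : ENNReal.ofReal m ≤ volume (Ioo (y - m) (y + m) \ Sᶜ) := by
    refine le_trans ?_ le_measure_sdiff
    rw [Real.volume_Ioo]
    calc ENNReal.ofReal m = ENNReal.ofReal (y + m - (y - m)) - ENNReal.ofReal m := by
          rw [← ENNReal.ofReal_sub _ hm.le]; congr 1; ring
      _ ≤ _ := by gcongr
  calc ENNReal.ofReal m⁻¹ = ENNReal.ofReal (1 / m ^ 2) * ENNReal.ofReal m := by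
        rw [← ENNReal.ofReal_mul (by positivity)]; congr 1; field_simp
    _ ≤ ENNReal.ofReal (1 / m ^ 2) * volume (Ioo (y - m) (y + m) \ Sᶜ) := by gcongr
    _ = ∫⁻ x in Ioo (y - m) (y + m) \ Sᶜ, ENNReal.ofReal (1 / m ^ 2) := by
        rw [setLIntegral_const]
    _ ≤ ∫⁻ x in Ioo (y - m) (y + m) \ Sᶜ, ENNReal.ofReal (1 / |x - y| ^ 2) := by
        refine lintegral_mono_ae ?_
        filter_upwards [ae_restrict_mem (measurableSet_Ioo.diff hS.compl),
          ae_restrict_of_ae (Measure.ae_ne volume y)] with x hx hxy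
        have h1 : 0 < |x - y| := abs_pos.2 (sub_ne_zero.2 hxy)
        have h2 : |x - y| ≤ m := abs_le.2 ⟨by linarith [hx.1.1], by linarith [hx.1.2]⟩
        gcongr
    _ ≤ _ := lintegral_mono_set fun x hx => by simpa using hx.2

theorem sum_level_gap_rpow_le {p : ℝ} (hp : 1 ≤ p) {t : ℕ → ℝ} (ht : Monotone t) (a b : ℝ)
    (n : ℕ) : ∑ k ∈ Finset.range n, (if t (k + 1) ≤ |b| ∧ |a| ≤ t k then
      (t (k + 1) - t k) ^ p else 0) ≤ |a - b| ^ p := by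
  -- Clamping to `[|a|, |b|]` (constant if `|b| ≤ |a|`) preserves every counted gap, and
  -- superadditivity of the `p`-th power makes the sum telescope.
  set c : ℝ → ℝ := fun r => min |b| (max r |a|) with hc
  have hcm : Monotone c := fun r r' h => min_le_min_left _ (max_le_max_right _ h)
  have hsum : ∑ k ∈ Finset.range n, (if t (k + 1) ≤ |b| ∧ |a| ≤ t k then
      (t (k + 1) - t k) ^ p else 0) ≤ (c (t n) - c (t 0)) ^ p := by
    induction n with
    | zero => simp [(by linarith : p ≠ 0)]
    | succ n ih =>
      rw [Finset.sum_range_succ]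
      have h1 : (if t (n + 1) ≤ |b| ∧ |a| ≤ t n then (t (n + 1) - t n) ^ p else 0) ≤
          (c (t (n + 1)) - c (t n)) ^ p := by
        split_ifs with h
        · have h2 := ht n.le_succ
          rw [hc]
          simp only
          rw [max_eq_left (h.2.trans h2), max_eq_left h.2, min_eq_right h.1,
            min_eq_right (h2.trans h.1)]
        · exact rpow_nonneg (sub_nonneg.2 (hcm (ht n.le_succ))) p
      refine (add_le_add ih h1).trans ((add_rpow_le_rpow_add (sub_nonneg.2 (hcm (ht n.zero_le)))
        (sub_nonneg.2 (hcm (ht n.le_succ))) hp).trans_eq ?_)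
      congr 1; ring
  refine hsum.trans (rpow_le_rpow (sub_nonneg.2 (hcm (ht n.zero_le))) ?_ (by linarith))
  have h1 : c (t n) ≤ |b| := min_le_left _ _
  have h2 : min |b| |a| ≤ c (t 0) := min_le_min_left _ (le_max_right _ _)
  have h3 := abs_sub_abs_le_abs_sub b a
  rw [abs_sub_comm] at h3
  rcases min_choice |b| |a| with h | h <;> rw [h] at h2
  · linarith [abs_nonneg (a - b)]
  · linarith

theorem sum_level_gap_le_energy {p : ℝ} (hp : 1 ≤ p) {u : ℝ → ℝ} (hu : Measurable u) {l : ℝ}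
    (hl : 0 < l) {t : ℕ → ℝ} (ht : Monotone t)
    (h1 : ∀ k, volume {x | t k < |u x|} ≤ ENNReal.ofReal (l / 2 ^ k))
    (h2 : ∀ k, t k < t (k + 1) → ENNReal.ofReal (l / 2 ^ (k + 1)) ≤ volume {x | t (k + 1) ≤ |u x|})
    (n : ℕ) :
    ENNReal.ofReal ((∑ k ∈ Finset.range n, (t (k + 1) - t k) ^ p) / 2) ≤ energy p u := by
  have hua : Measurable fun x => |u x| := hu.abs
  have hgap : ∀ k, 0 ≤ t (k + 1) - t k := fun k => sub_nonneg.2 (ht k.le_succ)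
  have hA : ∀ k, MeasurableSet {y | t (k + 1) ≤ |u y|} := fun k =>
    measurableSet_le measurable_const hua
  have hB : ∀ k, MeasurableSet {x | |u x| ≤ t k} := fun k => measurableSet_le hua measurable_const
  set g : ℕ → ℝ → ℝ → ENNReal := fun k y x =>
    {y | t (k + 1) ≤ |u y|}.indicator (fun y => {x | |u x| ≤ t k}.indicator (fun x =>
      ENNReal.ofReal ((t (k + 1) - t k) ^ p) * ENNReal.ofReal (1 / |x - y| ^ 2)) x) y with hg
  have hpt : ∀ y x, ∑ k ∈ Finset.range n, g k y x ≤
      ENNReal.ofReal (|u x - u y| ^ p / |x - y| ^ 2) := by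
    intro y x
    have h3 : ∀ k, g k y x = ENNReal.ofReal ((if t (k + 1) ≤ |u y| ∧ |u x| ≤ t k then
        (t (k + 1) - t k) ^ p else 0) * (1 / |x - y| ^ 2)) := by
      intro k
      simp only [hg, indicator_apply, mem_ofPred_eq]
      by_cases ha : t (k + 1) ≤ |u y| <;> by_cases hb : |u x| ≤ t k <;> simp [ha, hb]
      rw [ENNReal.ofReal_mul (rpow_nonneg (hgap k) p)]
    simp_rw [h3]
    rw [← ENNReal.ofReal_sum_of_nonneg, ← Finset.sum_mul, div_eq_mul_one_div (|u x - u y| ^ p)]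
    · gcongr
      exact sum_level_gap_rpow_le hp ht (u x) (u y) n
    · intro k _
      have := rpow_nonneg (hgap k) p
      split_ifs <;> positivity
  have hint : ∀ k, ENNReal.ofReal ((t (k + 1) - t k) ^ p / 2) ≤ ∫⁻ y, ∫⁻ x, g k y x := by
    intro k
    rcases (hgap k).eq_or_lt with h0 | hpos
    · rw [← h0, zero_rpow (by linarith)]; simp
    have h4 : ∀ y, {y | t (k + 1) ≤ |u y|}.indicator (fun _ =>
        ENNReal.ofReal ((t (k + 1) - t k) ^ p) * ENNReal.ofReal (l / 2 ^ k)⁻¹) y ≤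
        ∫⁻ x, g k y x := by
      intro y
      by_cases hy : y ∈ {y | t (k + 1) ≤ |u y|}
      · simp only [hg, indicator_of_mem hy]
        rw [lintegral_indicator (hB k), lintegral_const_mul' _ _ ENNReal.ofReal_ne_top]
        gcongr
        refine ofReal_inv_le_lintegral_kernel (hB k) (by positivity) ?_ y
        simpa only [compl_ofPred, not_le] using h1 k
      · simp [indicator_of_notMem hy]
    refine le_trans ?_ (lintegral_mono h4)
    rw [lintegral_indicator_const (hA k)]
    -- The kernel mass `2 ^ k / l` times the measure `l / 2 ^ (k + 1)` is `1 / 2` at every scale.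
    calc _ = ENNReal.ofReal ((t (k + 1) - t k) ^ p) * ENNReal.ofReal (l / 2 ^ k)⁻¹ *
          ENNReal.ofReal (l / 2 ^ (k + 1)) := by
          rw [← ENNReal.ofReal_mul (by positivity), ← ENNReal.ofReal_mul (by positivity)]
          congr 1
          field_simp
          ring
      _ ≤ _ := by gcongr; exact h2 k (sub_pos.1 hpos)
  calc _ = ∑ k ∈ Finset.range n, ENNReal.ofReal ((t (k + 1) - t k) ^ p / 2) := by
        rw [Finset.sum_div, ENNReal.ofReal_sum_of_nonneg]
        exact fun k _ => div_nonneg (rpow_nonneg (hgap k) p) zero_le_two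
    _ ≤ ∑ k ∈ Finset.range n, ∫⁻ y, ∫⁻ x, g k y x := Finset.sum_le_sum fun k _ => hint k
    _ ≤ ∫⁻ y, ∑ k ∈ Finset.range n, ∫⁻ x, g k y x := sum_lintegral_le _ _
    _ ≤ ∫⁻ y, ∫⁻ x, ∑ k ∈ Finset.range n, g k y x := lintegral_mono fun y => sum_lintegral_le _ _
    _ ≤ _ := lintegral_mono fun y => lintegral_mono fun x => hpt y x

/-! ### Exponential integrability for small exponents. -/

/-- Hölder on the telescoping sum gives `t n ^ p ≤ n ^ (p - 1) * M`. -/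
theorem rpow_le_of_sum_gap_rpow_le {p M : ℝ} (hp : 1 < p) (hM : 0 ≤ M) {t : ℕ → ℝ} (h0 : t 0 = 0)
    (ht : Monotone t) {n : ℕ} (h : ∑ k ∈ Finset.range n, (t (k + 1) - t k) ^ p ≤ M) :
    t n ^ (p / (p - 1)) ≤ M ^ (1 / (p - 1)) * n := by
  have hp1 : 0 < p - 1 := by linarith
  have htn : 0 ≤ t n := h0 ▸ ht n.zero_le
  have h1 := rpow_sum_le_const_mul_sum_rpow (Finset.range n) (fun k => t (k + 1) - t k) hp.le
  have h2 : ∀ k, |t (k + 1) - t k| = t (k + 1) - t k := fun k =>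
    abs_of_nonneg (sub_nonneg.2 (ht k.le_succ))
  simp only [h2, Finset.sum_range_sub, h0, sub_zero, Finset.card_range] at h1
  calc t n ^ (p / (p - 1)) = (t n ^ p) ^ (1 / (p - 1)) := by
        rw [← rpow_mul htn, mul_one_div]
    _ ≤ ((n : ℝ) ^ (p - 1) * M) ^ (1 / (p - 1)) := by
        gcongr
        exact h1.trans (by gcongr)
    _ = _ := by
        rw [mul_rpow (by positivity) hM, ← rpow_mul n.cast_nonneg, mul_one_div_cancel hp1.ne',
          rpow_one, mul_comm]

/-- The exponential integral is controlled by the levels at which the distribution function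
halves. -/
theorem lintegral_exp_le_of_levels {f : ℝ → ℝ} (hf : Measurable f) (hf0 : ∀ x, 0 ≤ f x) {I : Set ℝ}
    {l C q α : ℝ} (hq : 0 < q) (hα : 0 ≤ α) (hI : volume I ≤ ENNReal.ofReal l) {t : ℕ → ℝ}
    (h0 : t 0 = 0) (h1 : ∀ k, volume {x | t k < f x} ≤ ENNReal.ofReal (l / 2 ^ k))
    (h2 : ∀ k, t k ^ q ≤ C * k) (hC : 0 ≤ C) :
    ∫⁻ x in I, ENNReal.ofReal (exp (α * f x ^ q)) ≤ ENNReal.ofReal l +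
      ∑' k : ℕ, ENNReal.ofReal (exp (α * (C * (k + 1)))) * ENNReal.ofReal (l / 2 ^ k) := by
  have hm : ∀ k, MeasurableSet {x | t k < f x} := fun k => measurableSet_lt measurable_const hf
  have hpt : ∀ x, ENNReal.ofReal (exp (α * f x ^ q)) ≤ 1 + ∑' k : ℕ,
      {x | t k < f x}.indicator (fun _ => ENNReal.ofReal (exp (α * (C * (k + 1))))) x := by
    intro x
    by_cases hx : f x = 0
    · simp [hx, hq.ne']
    refine le_add_left ?_
    -- If every level is exceeded, infinitely many terms are at least one and the series diverges.
    -- Otherwise the last level before the first one reaching `f x` gives a sufficient term; it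
    -- exists because `t 0 = 0 < f x`.
    by_cases hall : ∀ k, t k < f x
    · have h3 : ∀ k : ℕ, (1 : ENNReal) ≤
          {x | t k < f x}.indicator (fun _ => ENNReal.ofReal (exp (α * (C * (k + 1))))) x := by
        intro k
        rw [indicator_of_mem (show x ∈ {x | t k < f x} from hall k), ENNReal.one_le_ofReal]
        exact one_le_exp (by positivity)
      refine le_top.trans (le_trans (le_of_eq ?_) (ENNReal.tsum_le_tsum h3))
      rw [ENNReal.tsum_const_eq_top_of_ne_zero one_ne_zero]
    · push Not at hall
      classical
      have hfind := Nat.find_spec hall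
      have hmin := fun k => Nat.find_min hall (m := k)
      obtain ⟨k, hk⟩ : ∃ k, Nat.find hall = k + 1 := by
        refine Nat.exists_eq_succ_of_ne_zero fun h => ?_
        rw [h, h0] at hfind
        exact hx (le_antisymm hfind (hf0 x))
      rw [hk] at hfind
      have hkx : x ∈ {x | t k < f x} := not_le.1 (hmin k (by omega))
      refine le_trans ?_ (ENNReal.le_tsum k)
      rw [indicator_of_mem hkx]
      have h3 : f x ^ q ≤ C * (k + 1) := by
        have := h2 (k + 1)
        push_cast at this
        exact (rpow_le_rpow (hf0 x) hfind hq.le).trans this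
      gcongr
  calc _ ≤ ∫⁻ x in I, (1 + ∑' k : ℕ,
        {x | t k < f x}.indicator (fun _ => ENNReal.ofReal (exp (α * (C * (k + 1))))) x) :=
        lintegral_mono hpt
    _ = volume I + ∑' k : ℕ, ENNReal.ofReal (exp (α * (C * (k + 1)))) *
          volume.restrict I {x | t k < f x} := by
        rw [lintegral_add_left measurable_const, setLIntegral_one,
          lintegral_tsum fun k => (measurable_const.indicator (hm k)).aemeasurable]
        simp_rw [lintegral_indicator_const (hm _)]
    _ ≤ _ := by
        gcongr with k
        exact (Measure.restrict_le_self _).trans (h1 k)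

theorem tsum_exp_mul_pow_lt_top {l β : ℝ} (hβ : β < log 2) :
    ∑' k : ℕ, ENNReal.ofReal (exp (β * (k + 1))) * ENNReal.ofReal (l / 2 ^ k) < ⊤ := by
  have h1 : ∀ k : ℕ, ENNReal.ofReal (exp (β * (k + 1))) * ENNReal.ofReal (l / 2 ^ k) =
      ENNReal.ofReal (l * exp β * (exp β / 2) ^ k) := by
    intro k
    rw [← ENNReal.ofReal_mul (exp_pos _).le]
    congr 1
    rw [mul_add, mul_one, exp_add, mul_comm β, exp_nat_mul, div_pow]
    ring
  have h2 : exp β / 2 < 1 := by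
    rw [div_lt_one two_pos, ← exp_log two_pos]
    exact exp_lt_exp.2 hβ
  simp_rw [h1]
  exact ((summable_geometric_of_lt_one (by positivity) h2).mul_left _).tsum_ofReal_lt_top

theorem expIntegral_le {s p : ℝ} (hs1 : s < 1) (hp : 1 < p) (hsp : s * p = 1) {a b α : ℝ}
    (hab : a < b) (hα : 0 ≤ α) {u : ℝ → ℝ} (hu : MemSobolevZero p (Ioo a b) u)
    (hG : gagliardo p u ≤ 1) :
    expIntegral s α (Ioo a b) u ≤ ENNReal.ofReal (b - a) + ∑' k : ℕ,
      ENNReal.ofReal (exp (α * (2 ^ (1 / (p - 1)) * (k + 1)))) *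
        ENNReal.ofReal ((b - a) / 2 ^ k) := by
  have hp0 : 0 < p := by linarith
  have hl : 0 < b - a := by linarith
  have h1s : 0 < 1 - s := by linarith
  have hexp : 1 / (1 - s) = p / (p - 1) := by
    rw [div_eq_div_iff h1s.ne' (by linarith)]; linarith
  -- `u` is only almost everywhere measurable, so the levels are taken for a measurable
  -- representative.
  obtain ⟨v, hv, huv⟩ := hu.1.1.1
  have hvm := hv.measurable
  have hE : energy p v ≤ 1 := by
    rw [← energy_congr_ae huv]
    rw [gagliardo_eq] at hG
    by_contra! hcon
    exact absurd hG (not_le.2 (ENNReal.one_lt_rpow hcon (by positivity)))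
  have hvol : volume {x | 0 < |v x|} ≤ ENNReal.ofReal (b - a) := by
    rw [← Real.volume_Ioo]
    refine measure_mono_ae ?_
    filter_upwards [hu.ae_eq_zero hp measurableSet_Ioo, huv] with x hx hxv hpos
    by_contra hxI
    have hpos : 0 < |v x| := hpos
    rw [← hxv, hx hxI, abs_zero] at hpos
    exact lt_irrefl _ hpos
  obtain ⟨t, ht0, htm, ht1, ht2⟩ := exists_dyadic_levels (f := fun x => |v x|) hvm.abs hl hvol
  have hsum : ∀ n, ∑ k ∈ Finset.range n, (t (k + 1) - t k) ^ p ≤ 2 := by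
    intro n
    have := (sum_level_gap_le_energy hp.le hvm hl htm ht1 ht2 n).trans hE
    rw [ENNReal.ofReal_le_one] at this
    linarith
  have hlev : ∀ n : ℕ, t n ^ (1 / (1 - s)) ≤ 2 ^ (1 / (p - 1)) * n := fun n => by
    rw [hexp]
    exact rpow_le_of_sum_gap_rpow_le hp zero_le_two ht0 htm (hsum n)
  have hcongr : expIntegral s α (Ioo a b) u = expIntegral s α (Ioo a b) v := by
    refine lintegral_congr_ae (ae_restrict_of_ae ?_)
    filter_upwards [huv] with x hx
    rw [hx]
  rw [hcongr]
  exact lintegral_exp_le_of_levels (f := fun x => |v x|) hvm.abs (fun x => abs_nonneg _)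
    (by positivity) hα Real.volume_Ioo.le ht0 ht1 hlev (by positivity)

theorem moserTrudingerSup_lt_top {s p : ℝ} (hs1 : s < 1) (hp : 1 < p) (hsp : s * p = 1)
    {a b α : ℝ} (hab : a < b) (hα : 0 ≤ α) (hlt : α < log 2 / 2 ^ (1 / (p - 1))) :
    moserTrudingerSup s p α (Ioo a b) < ⊤ := by
  refine lt_of_le_of_lt (iSup₂_le fun u hu => expIntegral_le hs1 hp hsp hab hα hu.1 hu.2) ?_
  rw [lt_div_iff₀ (by positivity)] at hlt
  simp_rw [← mul_assoc]
  exact ENNReal.add_lt_top.2 ⟨ENNReal.ofReal_lt_top,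
    tsum_exp_mul_pow_lt_top hlt⟩

end FracMT

theorem theorem1p1 (s p : ℝ) (hs0 : 0 < s) (hs1 : s < 1) (hp : 1 < p) (hsp : s * p = 1) :
    (∃ αs : ℝ, 0 < αs ∧
      ∀ a b : ℝ, a < b → ∀ α : ℝ, 0 ≤ α → α < αs →
        FracMT.moserTrudingerSup s p α (Set.Ioo a b) < ⊤) ∧
    (∀ a b : ℝ, a < b → ∀ α : ℝ, FracMT.gammaConst p ^ (s / (1 - s)) < α →
        FracMT.moserTrudingerSup s p α (Set.Ioo a b) = ⊤) :=
  -- Below this value the geometric ratio `exp (α * 2 ^ (1 / (p - 1))) / 2` is less than one.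
  ⟨⟨Real.log 2 / 2 ^ (1 / (p - 1)), div_pos (Real.log_pos one_lt_two) (by positivity),
    fun _ _ hab _ hα hlt => FracMT.moserTrudingerSup_lt_top hs1 hp hsp hab hα hlt⟩,
    fun _ _ hab _ hα => FracMT.moserTrudingerSup_eq_top hs0 hs1 hp hsp hab hα⟩
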